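/- Let $S=K[x_1,\dots,x_n]$ be the standard graded polynomial ring over a field $K$. A discrete polymatroid is a nonempty finite set $\mathcal P\subset\mathbb Z_{\ge 0}^n$ such that (i) if $u\in\mathcal P$ and $v\in\mathbb Z_{\ge0}^n$ with $v\le u$ componentwise, then $v\in\mathcal P$, and (ii) if $u,v\in\mathcal P$ and $u_1+\cdots+u_n<v_1+\cdots+v_n$, then there is an $i$ with $u_i<v_i$ such that $u+e_i\in\mathcal P$, where $e_i$ is the $i$-th unit vector; its bases are its maximal elements. A monomial ideal $I\subseteq S$ is called polymatroidal if the exponent vectors of its minimal monomial generators form the set of bases of a discrete polymatroid; the zero ideal is regarded as polymatroidal too. A polymatroidal ideal is called matroidal if its minimal monomial generators are squarefree. For $k\ge 1$ let $$I^{(k)}=\bigcap_{P\in\operatorname{Ass}(S/I)}\bigl(I^kS_P\cap S\bigr)$$ be the $k$-th symbolic power of $I$, and for a graded ideal $J\subseteq S$ let $\operatorname{reg} J$ be its Castelnuovo-Mumford regularity, i.e. if $\cdots\to F_1\to F_0\to J\to 0$ with $F_i=\bigoplus_{b}S(-a_{i,b})$ is the minimal graded free resolution of $J$, then $\operatorname{reg}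 J=\max_{i,b}\{a_{i,b}-i\}$ (with $\operatorname{reg}(0)=-\infty$). Let $I\subseteq S$ be a polymatroidal ideal without embedded associated primes, that is, every $P\in\operatorname{Ass}(S/I)$ is a minimal prime of $I$. Then $$\operatorname{reg} I^{(k)}\ \ge\ \operatorname{reg} I^{k}\qquad\text{for all } k\ge 1.$$ Moreover, every matroidal ideal has no embedded associated primes, so that the inequality holds in particular for all matroidal ideals. -/

import Mathlib

/-- The `k`-th symbolic power of an ideal `I` of a (Noetherian) ring `R`: the intersection, over
the associated primes `P` of `R ⧸ I`, of the contractions to `R` of `I ^ k R_P`. -/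
noncomputable def symbolicPower {R : Type*} [CommRing R] (I : Ideal R) (k : ℕ) : Ideal R :=
  ⨅ P : associatedPrimes R (R ⧸ I),
    ((I ^ k).map (algebraMap R (Localization.AtPrime P.1))).comap
      (algebraMap R (Localization.AtPrime P.1))

/-- `I` has no embedded associated primes: every associated prime of `R ⧸ I` is a minimal prime
of `I`. -/
def HasNoEmbeddedPrimes {R : Type*} [CommRing R] (I : Ideal R) : Prop :=
  ∀ P ∈ associatedPrimes R (R ⧸ I), P ∈ I.minimalPrimes

/-- A discrete polymatroid on the ground set `Fin n`: a nonempty finite set of vectors with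
nonnegative integer entries which is closed under passing to smaller vectors and in which a vector
of smaller modulus can be augmented from any vector of larger modulus. -/
structure IsDiscretePolymatroid {n : ℕ} (P : Set (Fin n →₀ ℕ)) : Prop where
  nonempty : P.Nonempty
  finite : P.Finite
  mem_of_le : ∀ u ∈ P, ∀ v, v ≤ u → v ∈ P
  augment : ∀ u ∈ P, ∀ v ∈ P, u.degree < v.degree →
    ∃ i, u i < v i ∧ u + Finsupp.single i 1 ∈ P

/-- The bases of a discrete polymatroid: its maximal vectors. -/
def polymatroidBases {n : ℕ} (P : Set (Fin n →₀ ℕ)) : Set (Fin n →₀ ℕ) :=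
  {u | Maximal (· ∈ P) u}

/-- A monomial ideal: an ideal generated by monomials. -/
def IsMonomialIdeal {n : ℕ} {K : Type*} [Field K] (I : Ideal (MvPolynomial (Fin n) K)) : Prop :=
  ∃ A : Set (Fin n →₀ ℕ), I = Ideal.span ((fun a => MvPolynomial.monomial a (1 : K)) '' A)

/-- The exponent vectors of the minimal monomial generators of a monomial ideal, that is, of the
monomials of `I` that are minimal with respect to divisibility. -/
def minimalExponents {n : ℕ} {K : Type*} [Field K] (I : Ideal (MvPolynomial (Fin n) K)) :
    Set (Fin n →₀ ℕ) :=
  {a | Minimal (fun b => MvPolynomial.monomial b (1 : K) ∈ I) a}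

/-- A polymatroidal ideal: a monomial ideal such that the exponent vectors of its minimal monomial
generators form the set of bases of a discrete polymatroid. The zero ideal is regarded as
polymatroidal too. -/
def IsPolymatroidal {n : ℕ} {K : Type*} [Field K] (I : Ideal (MvPolynomial (Fin n) K)) : Prop :=
  I = ⊥ ∨ (IsMonomialIdeal I ∧
    ∃ P : Set (Fin n →₀ ℕ), IsDiscretePolymatroid P ∧ minimalExponents I = polymatroidBases P)

/-- A matroidal ideal: a polymatroidal ideal whose minimal monomial generators are squarefree. -/
def IsMatroidal {n : ℕ} {K : Type*} [Field K] (I : Ideal (MvPolynomial (Fin n) K)) : Prop :=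
  IsPolymatroidal I ∧ ∀ a ∈ minimalExponents I, ∀ i, a i ≤ 1

/-- A graded free resolution `⋯ → F₁ → F₀ → I → 0` of a graded ideal `I` of the standard graded
polynomial ring `S = K[x₁, …, xₙ]` by finitely generated graded free modules.
The module `F i` is free on the finite set `B i`, and the basis element `b` has degree `deg i b`,
that is, `F i = ⨁ b, S(-deg i b)`. The maps are homogeneous of degree `0`: they are matrices each
of whose entries is a form of the degree dictated by the degrees of the basis elements (in
particular the entry is zero when this degree is negative). -/
structure GradedFreeResolution {n : ℕ} {K : Type*} [Field K]
    (I : Ideal (MvPolynomial (Fin n) K)) where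
  /-- the basis of the `i`-th free module -/
  B : ℕ → Type
  finite : ∀ i, Finite (B i)
  /-- the degrees of the basis elements -/
  deg : ∀ i, B i → ℤ
  /-- the differential -/
  d : ∀ i, (B (i + 1) →₀ MvPolynomial (Fin n) K) →ₗ[MvPolynomial (Fin n) K]
    (B i →₀ MvPolynomial (Fin n) K)
  /-- the augmentation `F₀ → I ⊆ S` -/
  aug : (B 0 →₀ MvPolynomial (Fin n) K) →ₗ[MvPolynomial (Fin n) K] MvPolynomial (Fin n) K
  aug_homogeneous : ∀ b, ∀ e ∈ (aug (Finsupp.single b 1)).support, (e.degree : ℤ) = deg 0 b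
  d_homogeneous : ∀ i b c, ∀ e ∈ (d i (Finsupp.single b 1) c).support,
    (e.degree : ℤ) = deg (i + 1) b - deg i c
  range_aug : LinearMap.range aug = I
  exact_zero : LinearMap.ker aug = LinearMap.range (d 0)
  exact_succ : ∀ i, LinearMap.ker (d i) = LinearMap.range (d (i + 1))

/-- A graded free resolution is minimal if `d (F (i + 1)) ⊆ 𝔪 F i` for all `i`, that is, if all
entries of the matrices of the differentials lie in `𝔪 = (x₁, …, xₙ)`. -/
def GradedFreeResolution.IsMinimal {n : ℕ} {K : Type*} [Field K]
    {I : Ideal (MvPolynomial (Fin n) K)} (F : GradedFreeResolution I) : Prop :=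
  ∀ i b c, F.d i (Finsupp.single b 1) c ∈
    Ideal.span (Set.range (MvPolynomial.X : Fin n → MvPolynomial (Fin n) K))

/-- The Castelnuovo-Mumford regularity of a graded ideal `I`: the maximum of `j - i` over all
`i, j` such that `S(-j)` is a direct summand of the `i`-th module of the minimal graded free
resolution of `I`. The minimal graded free resolution of `I` exists and is unique up to
isomorphism, so that the outer infimum is over copies of one and the same value. The value is an
integer, except that the zero ideal has regularity `-∞`. -/
noncomputable def regularity {n : ℕ} {K : Type*} [Field K]
    (I : Ideal (MvPolynomial (Fin n) K)) : EReal :=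
  ⨅ (F : GradedFreeResolution I) (_ : F.IsMinimal),
    ⨆ (i : ℕ) (b : F.B i), (((F.deg i b - (i : ℤ) : ℤ) : ℝ) : EReal)

/-!
Let `B` be the set of bases and `d` their common degree; `I` is generated by the monomials `x ^ u`,
`u ∈ B`.

Upper bound `reg (I ^ k) ≤ k d`. The set `k • B` again has the exchange property, so the monomials
generating `I ^ k`, in lexicographic order, have linear quotients: each colon ideal of the earlier
ones by the next one is generated by variables. The linear syzygies of a family with linear
quotients generate all its syzygies and again have linear quotients. Iterating gives a minimal
linear resolution.

Lower bound `k d ≤ reg I ^ (k)`, for the symbolic power `I ^ (k)`. The degree of a minimal monomial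
of an ideal occurs in the first module of every graded free resolution, so it is enough that
`x ^ (k u)` is minimal in `I ^ (k)` for `u ∈ B`. Given `i` with `u i > 0`, an associated prime of
`I` containing the annihilator of `x ^ (u - e_i)` modulo `I` is a minimal prime, hence generated by
the variables in a set `T`, and `i ∈ T`. Because the prime is minimal, the exchange property shows
that `u` has the least `T`-degree among the bases. All monomials of an element of `I ^ (k)` have
`T`-degree at least `k` times this minimum, so the exponent of `x_i` in `x ^ (k u)` cannot be
lowered.

A squarefree monomial ideal is radical, and a radical ideal has no embedded primes.
-/

open MvPolynomial
open scoped Pointwise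

section Exchange

variable {σ : Type*}

/-- The one-sided basis exchange property of a set `B` of exponent vectors: if `u ∈ B` exceeds
`v ∈ B` in the coordinate `s`, then `u - e_s + e_p ∈ B` for some `p` in which `v` exceeds `u`. The
vector `w = u - e_s + e_p` is described by an equation without subtraction. -/
def HasExchange (B : Set (σ →₀ ℕ)) : Prop :=
  ∀ u ∈ B, ∀ v ∈ B, ∀ s, v s < u s → ∃ p, u p < v p ∧
    ∃ w ∈ B, w + Finsupp.single s 1 = u + Finsupp.single p 1

theorem apply_add_ite_of_add_single_eq [DecidableEq σ] {u w : σ →₀ ℕ} {s p : σ}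
    (h : w + Finsupp.single s 1 = u + Finsupp.single p 1) (l : σ) :
    w l + (if s = l then 1 else 0) = u l + (if p = l then 1 else 0) := by
  simpa only [Finsupp.add_apply, Finsupp.single_apply] using DFunLike.congr_fun h l

theorem sum_tsub_lt_sum_tsub_of_exchange {T : Finset σ} {u v w : σ →₀ ℕ} {s p : σ}
    (hs : s ∈ T) (hvs : v s < u s) (hp : p ∈ T → u p < v p)
    (h : w + Finsupp.single s 1 = u + Finsupp.single p 1) :
    ∑ l ∈ T, (w l - v l) < ∑ l ∈ T, (u l - v l) := by
  classical
  have hw := apply_add_ite_of_add_single_eq h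
  exact Finset.sum_lt_sum (fun l hl => by grind) ⟨s, hs, by grind⟩

theorem HasExchange.add [Finite σ] {B C : Set (σ →₀ ℕ)} (hB : HasExchange B)
    (hC : HasExchange C) : HasExchange (B + C) := by
  have := Fintype.ofFinite σ
  rintro - ⟨u₁, hu₁, u₂, hu₂, rfl⟩ - ⟨v₁, hv₁, v₂, hv₂, rfl⟩ s hs
  -- Repair the summands: as long as the unit taken from `s` has been moved to a coordinate `q`
  -- where `v₁ + v₂` is not larger, move it on inside one of the two summands.
  suffices H : ∀ a₁ ∈ B, ∀ a₂ ∈ C, ∀ q,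
      a₁ + a₂ + Finsupp.single s 1 = u₁ + u₂ + Finsupp.single q 1 →
      ∃ p, (u₁ + u₂) p < (v₁ + v₂) p ∧
        ∃ w ∈ B + C, w + Finsupp.single s 1 = u₁ + u₂ + Finsupp.single p 1 from
    H u₁ hu₁ u₂ hu₂ s rfl
  intro a₁ ha₁ a₂ ha₂ q hq
  induction hN : ∑ l, (a₁ l - v₁ l) + ∑ l, (a₂ l - v₂ l) using Nat.strong_induction_on
    generalizing a₁ a₂ q with
  | _ N ih =>
  by_cases hqv : (u₁ + u₂) q < (v₁ + v₂) q
  · exact ⟨q, hqv, a₁ + a₂, Set.add_mem_add ha₁ ha₂, hq⟩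
  have hgt : v₁ q < a₁ q ∨ v₂ q < a₂ q := by
    classical
    have := apply_add_ite_of_add_single_eq hq q
    simp only [Finsupp.add_apply] at *
    grind
  rcases hgt with h₁ | h₂
  · obtain ⟨p, hp, w, hw, hwp⟩ := hB a₁ ha₁ v₁ hv₁ q h₁
    have hlt := sum_tsub_lt_sum_tsub_of_exchange (Finset.mem_univ q) h₁ (fun _ => hp) hwp
    refine ih _ (by omega) w hw a₂ ha₂ p ?_ rfl
    apply add_right_cancel (b := Finsupp.single q 1)
    grind
  · obtain ⟨p, hp, w, hw, hwp⟩ := hC a₂ ha₂ v₂ hv₂ q h₂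
    have hlt := sum_tsub_lt_sum_tsub_of_exchange (Finset.mem_univ q) h₂ (fun _ => hp) hwp
    refine ih _ (by omega) a₁ ha₁ w hw p ?_ rfl
    apply add_right_cancel (b := Finsupp.single q 1)
    grind

theorem HasExchange.nsmul [Finite σ] {B : Set (σ →₀ ℕ)} (hB : HasExchange B) (k : ℕ) :
    HasExchange (k • B) := by
  induction k with
  | zero =>
    rw [zero_nsmul]
    rintro u rfl v rfl s hs
    exact absurd hs (lt_irrefl _)
  | succ k ih => rw [succ_nsmul]; exact ih.add hB

theorem HasExchange.exists_le_on {B : Set (σ →₀ ℕ)} (hB : HasExchange B) {T : Finset σ}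
    (hT : ∀ l ∈ T, ∃ v ∈ B, ∀ m ∈ T, m ≠ l → v m = 0) {a w₀ : σ →₀ ℕ} (hw₀ : w₀ ∈ B)
    (hsum : ∑ l ∈ T, w₀ l ≤ ∑ l ∈ T, a l) : ∃ w ∈ B, ∀ l ∈ T, w l ≤ a l := by
  induction hN : ∑ l ∈ T, (w₀ l - a l) using Nat.strong_induction_on generalizing w₀ with
  | _ N ih =>
  by_contra! hcon
  obtain ⟨s, hs, has⟩ := hcon w₀ hw₀
  obtain ⟨m, hm, hma⟩ : ∃ m ∈ T, w₀ m < a m := by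
    by_contra! hge
    exact hsum.not_gt (Finset.sum_lt_sum hge ⟨s, hs, has⟩)
  obtain ⟨v, hv, hv0⟩ := hT m hm
  have hsm : s ≠ m := by rintro rfl; omega
  obtain ⟨p, hp, w, hw, hwp⟩ := hB w₀ hw₀ v hv s (by rw [hv0 s hs hsm]; omega)
  have hpT : p ∈ T → p = m := fun h => by
    by_contra hpm
    rw [hv0 p h hpm] at hp
    omega
  have hlt : ∑ l ∈ T, (w l - a l) < ∑ l ∈ T, (w₀ l - a l) :=
    sum_tsub_lt_sum_tsub_of_exchange hs has (fun h => hpT h ▸ hma) hwp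
  refine absurd (ih _ (hN ▸ hlt) hw ?_ rfl) (by simpa using hcon)
  classical
  have hsums := Finset.sum_congr (rfl : T = T) fun l _ => apply_add_ite_of_add_single_eq hwp l
  simp only [Finset.sum_add_distrib, Finset.sum_ite_eq, if_pos hs] at hsums
  grind

end Exchange

section Polymatroid

variable {n : ℕ} {P : Set (Fin n →₀ ℕ)} {u v : Fin n →₀ ℕ}

namespace IsDiscretePolymatroid

theorem degree_le (hP : IsDiscretePolymatroid P) (hu : u ∈ polymatroidBases P) (hv : v ∈ P) :
    v.degree ≤ u.degree := by
  by_contra! h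
  obtain ⟨i, -, hi⟩ := hP.augment u hu.1 v hv h
  simpa using hu.2 hi le_self_add i

theorem degree_eq (hP : IsDiscretePolymatroid P) (hu : u ∈ polymatroidBases P)
    (hv : v ∈ polymatroidBases P) : v.degree = u.degree :=
  le_antisymm (hP.degree_le hu hv.1) (hP.degree_le hv hu.1)

theorem mem_polymatroidBases_of_degree_eq (hP : IsDiscretePolymatroid P)
    (hu : u ∈ polymatroidBases P) (hv : v ∈ P) (h : v.degree = u.degree) :
    v ∈ polymatroidBases P := by
  obtain ⟨w, hvw, hw⟩ := hP.finite.exists_le_maximal hv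
  have hdeg : w.degree = v.degree := (hP.degree_eq hu hw).trans h.symm
  obtain ⟨c, rfl⟩ := exists_add_of_le hvw
  rw [map_add, Nat.add_eq_left, Finsupp.degree_eq_zero_iff] at hdeg
  rwa [hdeg, add_zero] at hw

theorem hasExchange_polymatroidBases (hP : IsDiscretePolymatroid P) :
    HasExchange (polymatroidBases P) := by
  intro u hu v hv s hs
  obtain ⟨c, rfl⟩ : ∃ c, u = Finsupp.single s 1 + c :=
    exists_add_of_le (Finsupp.single_le_iff.2 (by omega))
  have hc : c ∈ P := hP.mem_of_le _ hu.1 c le_add_self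
  have hdeg : 1 + c.degree = v.degree := by
    rw [hP.degree_eq hu hv, map_add, Finsupp.degree_single]
  obtain ⟨p, hp, hcp⟩ := hP.augment c hc v hv.1 (by omega)
  have hsp : s ≠ p := by
    rintro rfl
    rw [Finsupp.add_apply, Finsupp.single_eq_same] at hs
    omega
  refine ⟨p, by simpa [Finsupp.single_apply, hsp] using hp, c + Finsupp.single p 1, ?_, by abel⟩
  exact hP.mem_polymatroidBases_of_degree_eq hu hcp (by simp [add_comm])

end IsDiscretePolymatroid

end Polymatroid

theorem induction_of_mem_nsmul {M : Type*} [AddMonoid M] {B : Set M} {p : ℕ → M → Prop}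
    (zero : p 0 0) (add : ∀ k, ∀ a, ∀ b ∈ B, p k a → p (k + 1) (a + b)) {k : ℕ} {u : M}
    (hu : u ∈ k • B) : p k u := by
  induction k generalizing u with
  | zero =>
    rw [zero_nsmul] at hu
    rwa [Set.mem_zero.1 hu]
  | succ k ih =>
    rw [succ_nsmul] at hu
    obtain ⟨a, ha, b, hb, rfl⟩ := hu
    exact add k a b hb (ih ha)

theorem finite_nsmul {M : Type*} [AddMonoid M] {B : Set M} (hB : B.Finite) (k : ℕ) :
    (k • B).Finite := by
  induction k with
  | zero => rw [zero_nsmul]; exact Set.finite_zero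
  | succ k ih => rw [succ_nsmul]; exact ih.add hB

theorem span_monomial_image_pow {σ R : Type*} [CommSemiring R] (B : Set (σ →₀ ℕ)) (k : ℕ) :
    Ideal.span ((fun a => monomial a (1 : R)) '' B) ^ k =
      Ideal.span ((fun a => monomial a (1 : R)) '' (k • B)) := by
  induction k with
  | zero => simp [Ideal.one_eq_top]
  | succ k ih =>
    rw [pow_succ, ih, Ideal.span_mul_span', succ_nsmul]
    congr 1
    ext f
    simp [Set.mem_mul, Set.mem_add]

section LinearQuotients

variable {R σ N ι : Type*} [CommRing R] [AddCommGroup N] [Module (MvPolynomial σ R) N]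
  [LinearOrder ι]

/-- A linear syzygy of the family `g` with leading term `X t • e_j`: a relation among the members of
`g` up to `g j` whose coefficients are linear forms, the coefficient of `g j` being `X t`. -/
structure IsLinearSyzygy (g : ι → N) (j : ι) (t : σ) (z : ι →₀ MvPolynomial σ R) : Prop where
  mem_ker : z ∈ LinearMap.ker (Finsupp.linearCombination (MvPolynomial σ R) g)
  isHomogeneous : ∀ l, (z l).IsHomogeneous 1
  apply_self : z j = X t
  apply_eq_zero : ∀ l, j < l → z l = 0

variable (R) in
/-- A family `g` in a module over a polynomial ring has linear quotients, given by the sets of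
variables `T j`: the colon ideal `(span of the earlier members) : g j` is generated by the variables
`X t` with `t ∈ T j`, and the relations witnessing this are linear. -/
structure HasLinearQuotients (g : ι → N) (T : ι → Set σ) : Prop where
  exists_syzygy : ∀ j, ∀ t ∈ T j, ∃ z : ι →₀ MvPolynomial σ R, IsLinearSyzygy g j t z
  mem_span_X : ∀ j, ∀ f : MvPolynomial σ R,
    f • g j ∈ Submodule.span (MvPolynomial σ R) (g '' Set.Iio j) → f ∈ Ideal.span (X '' T j)

/-- The index set of the linear syzygies of a family with linear quotients: the pair `(j, t)` stands
for the syzygy with leading term `X t • e_j`. -/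
abbrev SyzygyIndex (T : ι → Set σ) : Type _ :=
  {p : ι ×ₗ σ // (ofLex p).2 ∈ T (ofLex p).1}

namespace SyzygyIndex

variable {T : ι → Set σ}

/-- The position of the leading term of a linear syzygy. -/
abbrev pos (p : SyzygyIndex T) : ι := (ofLex p.1).1

/-- The variable in the leading term of a linear syzygy. -/
abbrev var (p : SyzygyIndex T) : σ := (ofLex p.1).2

theorem lt_iff [LinearOrder σ] {p q : SyzygyIndex T} :
    p < q ↔ p.pos < q.pos ∨ p.pos = q.pos ∧ p.var < q.var := by
  rw [← Subtype.coe_lt_coe, Prod.Lex.lt_iff]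

end SyzygyIndex

namespace HasLinearQuotients

variable {g : ι → N} {T : ι → Set σ} (h : HasLinearQuotients R g T)

/-- The linear syzygies of a family with linear quotients, one for each possible leading term. -/
noncomputable def syzygy (p : SyzygyIndex T) : ι →₀ MvPolynomial σ R :=
  (h.exists_syzygy p.pos p.var p.2).choose

theorem isLinearSyzygy_syzygy (p : SyzygyIndex T) : IsLinearSyzygy g p.pos p.var (h.syzygy p) :=
  (h.exists_syzygy p.pos p.var p.2).choose_spec

include h in
theorem apply_mem_span_X {v : ι →₀ MvPolynomial σ R} {j : ι}
    (hv : v ∈ LinearMap.ker (Finsupp.linearCombination (MvPolynomial σ R) g))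
    (hj : ∀ l, j < l → v l = 0) : v j ∈ Ideal.span (X '' T j) := by
  refine h.mem_span_X j _ ?_
  rw [← Finsupp.single_add_erase j v, LinearMap.mem_ker, map_add,
    Finsupp.linearCombination_single, add_eq_zero_iff_eq_neg] at hv
  rw [hv, Submodule.neg_mem_iff, Finsupp.mem_span_image_iff_linearCombination]
  refine ⟨v.erase j, (Finsupp.mem_supported _ _).2 fun l hl => ?_, rfl⟩
  rw [Finsupp.support_erase, Finset.coe_erase] at hl
  exact lt_of_le_of_ne (not_lt.1 fun hjl => Finsupp.mem_support_iff.1 hl.1 (hj l hjl)) hl.2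

theorem exists_mem_span_syzygy_apply_eq {j : ι} {f : MvPolynomial σ R}
    (hf : f ∈ Ideal.span (X '' T j)) :
    ∃ w ∈ Submodule.span (MvPolynomial σ R) (h.syzygy '' {p | p.pos = j}), w j = f := by
  suffices H : Ideal.span (X '' T j) ≤ (Submodule.span (MvPolynomial σ R)
      (h.syzygy '' {p | p.pos = j})).map (Finsupp.lapply j) from H hf
  rw [Ideal.span, Submodule.span_le]
  rintro - ⟨t, ht, rfl⟩
  let p : SyzygyIndex T := ⟨toLex (j, t), ht⟩
  exact ⟨h.syzygy p, Submodule.subset_span ⟨p, rfl, rfl⟩, (h.isLinearSyzygy_syzygy p).apply_self⟩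

theorem span_syzygy_le_ker (A : Set (SyzygyIndex T)) :
    Submodule.span (MvPolynomial σ R) (h.syzygy '' A) ≤
      LinearMap.ker (Finsupp.linearCombination (MvPolynomial σ R) g) := by
  rw [Submodule.span_le]
  rintro - ⟨p, -, rfl⟩
  exact (h.isLinearSyzygy_syzygy p).mem_ker

theorem apply_eq_zero_of_mem_span_syzygy {w : ι →₀ MvPolynomial σ R} {j l : ι}
    (hw : w ∈ Submodule.span (MvPolynomial σ R) (h.syzygy '' {p | p.pos = j})) (hl : j < l) :
    w l = 0 := by
  suffices H : Submodule.span (MvPolynomial σ R) (h.syzygy '' {p | p.pos = j}) ≤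
      LinearMap.ker (Finsupp.lapply l) from H hw
  rw [Submodule.span_le]
  rintro - ⟨p, rfl, rfl⟩
  exact (h.isLinearSyzygy_syzygy p).apply_eq_zero l hl

theorem mem_span_syzygy_of_mem_ker [Finite ι] {L : Set ι} (hL : IsLowerSet L)
    {v : ι →₀ MvPolynomial σ R}
    (hv : v ∈ LinearMap.ker (Finsupp.linearCombination (MvPolynomial σ R) g))
    (hvL : ∀ l, v l ≠ 0 → l ∈ L) :
    v ∈ Submodule.span (MvPolynomial σ R) (h.syzygy '' {p | p.pos ∈ L}) := by
  induction L using WellFoundedLT.induction generalizing v with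
  | _ L ih =>
  rcases v.support.eq_empty_or_nonempty with h0 | hne
  · rw [Finsupp.support_eq_empty.1 h0]
    exact zero_mem _
  -- Cancel the last nonzero entry of `v`, at `j`, by a combination `w` of syzygies leading at `j`.
  obtain ⟨j, hj, hmax⟩ := v.support.exists_max_image id hne
  have hvj : ∀ l, j < l → v l = 0 := fun l hl =>
    Finsupp.notMem_support_iff.1 fun hmem => (hmax l hmem).not_gt hl
  have hjL : j ∈ L := hvL j (Finsupp.mem_support_iff.1 hj)
  obtain ⟨w, hw, hwj⟩ := h.exists_mem_span_syzygy_apply_eq (h.apply_mem_span_X hv hvj)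
  have hIio : Set.Iio j ⊆ L := fun l hl => hL (le_of_lt hl) hjL
  have hsub : v - w ∈ Submodule.span (MvPolynomial σ R)
      (h.syzygy '' {p | p.pos ∈ Set.Iio j}) := by
    refine ih _ ⟨hIio, fun hle => lt_irrefl j (hle hjL)⟩ (isLowerSet_Iio j)
      (sub_mem hv (h.span_syzygy_le_ker _ hw)) fun l hl => ?_
    contrapose! hl
    rw [Finsupp.sub_apply, sub_eq_zero]
    rcases (not_lt.1 hl).eq_or_lt with rfl | hjl
    · exact hwj.symm
    · rw [hvj l hjl, h.apply_eq_zero_of_mem_span_syzygy hw hjl]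
  rw [← sub_add_cancel v w]
  refine add_mem (Submodule.span_mono (Set.image_mono ?_) hsub)
    (Submodule.span_mono (Set.image_mono ?_) hw)
  · exact fun p hp => hIio hp
  · rintro p rfl
    exact hjL

theorem ker_eq_range_syzygy [Finite ι] :
    LinearMap.ker (Finsupp.linearCombination (MvPolynomial σ R) g) =
      LinearMap.range (Finsupp.linearCombination (MvPolynomial σ R) h.syzygy) := by
  rw [Finsupp.range_linearCombination, ← Set.image_univ]
  exact le_antisymm (fun v hv => h.mem_span_syzygy_of_mem_ker isLowerSet_univ hv
    fun _ _ => Set.mem_univ _) (h.span_syzygy_le_ker _)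

end HasLinearQuotients

theorem homogeneousComponent_mul_of_isHomogeneous {f g : MvPolynomial σ R} {r : ℕ}
    (hg : g.IsHomogeneous r) (m : ℕ) :
    homogeneousComponent (m + r) (f * g) = homogeneousComponent m f * g := by
  induction f using MvPolynomial.induction_on' with
  | monomial d c =>
    have hd : (monomial d c).IsHomogeneous d.degree := isHomogeneous_monomial c rfl
    rw [homogeneousComponent_of_mem hd, homogeneousComponent_of_mem (hd.mul hg)]
    simp only [add_left_inj, ite_mul, zero_mul]
  | add p q hp hq => rw [add_mul, map_add, hp, hq, map_add, add_mul]

theorem exists_isHomogeneous_coeffs_of_mem_span {κ μ : Type*} {z : κ → μ →₀ MvPolynomial σ R}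
    {m r : ℕ} (hz : ∀ p l, (z p l).IsHomogeneous r) {A : Set κ} {y : μ →₀ MvPolynomial σ R}
    (hy : y ∈ Submodule.span (MvPolynomial σ R) (z '' A))
    (hyh : ∀ l, (y l).IsHomogeneous (m + r)) :
    ∃ c : κ →₀ MvPolynomial σ R, (∀ p, (c p).IsHomogeneous m) ∧ (∀ p, p ∉ A → c p = 0) ∧
      Finsupp.linearCombination _ z c = y := by
  rw [Finsupp.mem_span_image_iff_linearCombination] at hy
  obtain ⟨c, hc, rfl⟩ := hy
  refine ⟨c.mapRange (homogeneousComponent m) (map_zero _),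
    fun p => homogeneousComponent_isHomogeneous _ _, fun p hp => ?_, ?_⟩
  · rw [Finsupp.mapRange_apply, Finsupp.notMem_support_iff.1 fun h => hp (hc h), map_zero]
  · ext1 l
    rw [← homogeneousComponent_eq_self (hyh l), Finsupp.linearCombination_apply,
      Finsupp.linearCombination_apply, Finsupp.sum_mapRange_index (by simp), Finsupp.sum,
      Finsupp.sum, Finsupp.finsetSum_apply, Finsupp.finsetSum_apply, map_sum]
    exact Finset.sum_congr rfl fun p _ =>
      (homogeneousComponent_mul_of_isHomogeneous (hz p l) m).symm

theorem isHomogeneous_single_X {κ : Type*} (j : κ) (t : σ) (l : κ) :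
    (Finsupp.single j (X t : MvPolynomial σ R) l).IsHomogeneous 1 := by
  classical
  rw [Finsupp.single_apply]
  split_ifs
  · exact isHomogeneous_X _ _
  · exact isHomogeneous_zero _ _ _

theorem mem_span_X_of_mul_X_mem {A : Set σ} {t : σ} (ht : t ∉ A) {f : MvPolynomial σ R}
    (h : f * X t ∈ Ideal.span (X '' A)) : f ∈ Ideal.span (X '' A) := by
  classical
  rw [mem_ideal_span_X_image] at h ⊢
  intro m hm
  obtain ⟨i, hi, him⟩ := h (m + Finsupp.single t 1)
    (by rwa [mem_support_iff, coeff_mul_X, ← mem_support_iff])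
  have hti : t ≠ i := by rintro rfl; exact ht hi
  exact ⟨i, hi, by simpa [Finsupp.single_apply, hti] using him⟩

namespace HasLinearQuotients

variable [LinearOrder σ] {g : ι → N} {T : ι → Set σ} (h : HasLinearQuotients R g T)

theorem exists_syzygy_syzygy [Finite ι] {p q : SyzygyIndex T} (hpos : q.pos = p.pos)
    (hvar : q.var < p.var) :
    ∃ z : SyzygyIndex T →₀ MvPolynomial σ R, IsLinearSyzygy h.syzygy p q.var z := by
  have hp := h.isLinearSyzygy_syzygy p
  have hq := h.isLinearSyzygy_syzygy q
  -- The S-pair of two syzygies leading at the same position involves only earlier positions.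
  set y := (X q.var : MvPolynomial σ R) • h.syzygy p - (X p.var : MvPolynomial σ R) • h.syzygy q
  have hy0 : ∀ l, y l ≠ 0 → l ∈ Set.Iio p.pos := by
    intro l hl
    contrapose! hl
    simp only [y, Finsupp.sub_apply, Finsupp.smul_apply, smul_eq_mul]
    rcases (not_lt.1 hl).eq_or_lt with rfl | hl
    · rw [hp.apply_self, ← hpos, hq.apply_self, mul_comm, sub_self]
    · rw [hp.apply_eq_zero l hl, hq.apply_eq_zero l (hpos ▸ hl), mul_zero, mul_zero, sub_zero]
  have hy := h.mem_span_syzygy_of_mem_ker (isLowerSet_Iio p.pos) (v := y)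
    (sub_mem (Submodule.smul_mem _ _ hp.mem_ker) (Submodule.smul_mem _ _ hq.mem_ker)) hy0
  obtain ⟨c, hc, hc0, hcy⟩ := exists_isHomogeneous_coeffs_of_mem_span (m := 1)
    (fun r => (h.isLinearSyzygy_syzygy r).isHomogeneous) hy
    fun l => ((isHomogeneous_X R _).mul (hp.isHomogeneous l)).sub
      ((isHomogeneous_X R _).mul (hq.isHomogeneous l))
  have hqp : q < p := SyzygyIndex.lt_iff.2 (Or.inr ⟨hpos, hvar⟩)
  have hc_zero : ∀ r, p ≤ r → c r = 0 := fun r hr =>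
    hc0 r fun hlt => hr.not_gt (SyzygyIndex.lt_iff.2 (Or.inl hlt))
  refine ⟨Finsupp.single p (X q.var) - Finsupp.single q (X p.var) - c, ?_, fun l => ?_, ?_, ?_⟩
  · rw [LinearMap.mem_ker, map_sub, map_sub, Finsupp.linearCombination_single,
      Finsupp.linearCombination_single, hcy, sub_self]
  · exact ((isHomogeneous_single_X _ _ _).sub (isHomogeneous_single_X _ _ _)).sub (hc l)
  · simp [hc_zero p le_rfl, hqp.ne']
  · intro l hl
    simp [hc_zero l hl.le, hl.ne', (hqp.trans hl).ne']

theorem hasLinearQuotients_syzygy [Finite ι] :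
    HasLinearQuotients R h.syzygy (fun p => {t | t ∈ T p.pos ∧ t < p.var}) where
  exists_syzygy p t ht :=
    h.exists_syzygy_syzygy (q := ⟨toLex (p.pos, t), ht.1⟩) rfl ht.2
  mem_span_X p f hf := by
    -- Read off the entry at the leading position of `p`.
    refine mem_span_X_of_mul_X_mem (t := p.var) (fun ht => lt_irrefl _ ht.2) ?_
    have hmem := Submodule.mem_map_of_mem
      (f := Finsupp.lapply (R := MvPolynomial σ R) p.pos) hf
    rw [Submodule.map_span, Finsupp.lapply_apply, Finsupp.smul_apply,
      (h.isLinearSyzygy_syzygy p).apply_self] at hmem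
    refine (Submodule.span_le.2 ?_ : _ ≤ Ideal.span _) hmem
    rintro - ⟨-, ⟨q, hq, rfl⟩, rfl⟩
    rw [Finsupp.lapply_apply]
    rcases SyzygyIndex.lt_iff.1 hq with hlt | ⟨heq, hlt⟩
    · rw [(h.isLinearSyzygy_syzygy q).apply_eq_zero _ hlt]
      exact zero_mem _
    · rw [← heq, (h.isLinearSyzygy_syzygy q).apply_self]
      exact Ideal.subset_span ⟨_, ⟨q.2, hlt⟩, rfl⟩

end HasLinearQuotients

end LinearQuotients

section LinearResolution

universe u

variable {n : ℕ} {K : Type u} [Field K]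

instance SyzygyIndex.instFinite {ι σ : Type*} [Finite ι] [Finite σ]
    (T : ι → Set σ) : Finite (SyzygyIndex T) :=
  haveI : Finite (ι ×ₗ σ) := inferInstanceAs (Finite (ι × σ))
  inferInstance

variable (n K) in
/-- A bundled finite family `g` with linear quotients in some module `N` over `K[x₁, …, xₙ]`.
Bundling the ambient module makes it possible to iterate the passage to the linear syzygies. -/
structure LinearQuotientFamily : Type (u + 1) where
  N : Type u
  [addCommGroup : AddCommGroup N]
  [module : Module (MvPolynomial (Fin n) K) N]
  ι : Type
  [linearOrder : LinearOrder ι]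
  [finite : Finite ι]
  g : ι → N
  T : ι → Set (Fin n)
  hasLinearQuotients : HasLinearQuotients K g T

namespace LinearQuotientFamily

attribute [instance] addCommGroup module linearOrder finite

/-- The family of linear syzygies of a family with linear quotients. -/
noncomputable def syzygies (s : LinearQuotientFamily n K) : LinearQuotientFamily n K where
  N := s.ι →₀ MvPolynomial (Fin n) K
  ι := SyzygyIndex s.T
  g := s.hasLinearQuotients.syzygy
  T := _
  hasLinearQuotients := s.hasLinearQuotients.hasLinearQuotients_syzygy

/-- The family of `i`-th linear syzygies of a family with linear quotients. -/
noncomputable def iteratedSyzygies (s : LinearQuotientFamily n K) : ℕ → LinearQuotientFamily n K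
  | 0 => s
  | i + 1 => (s.iteratedSyzygies i).syzygies

/-- The matrix of the `i`-th differential of the linear free resolution of the module generated by a
family with linear quotients. -/
noncomputable def matrix (s : LinearQuotientFamily n K) (i : ℕ) :
    (s.iteratedSyzygies (i + 1)).ι → (s.iteratedSyzygies i).ι →₀ MvPolynomial (Fin n) K :=
  (s.iteratedSyzygies i).hasLinearQuotients.syzygy

theorem isHomogeneous_linearCombination_matrix (s : LinearQuotientFamily n K) (i : ℕ)
    (b : (s.iteratedSyzygies (i + 1)).ι) (c : (s.iteratedSyzygies i).ι) :
    (Finsupp.linearCombination (MvPolynomial (Fin n) K) (s.matrix i)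
      (Finsupp.single b 1) c).IsHomogeneous 1 := by
  rw [Finsupp.linearCombination_single, one_smul]
  exact ((s.iteratedSyzygies i).hasLinearQuotients.isLinearSyzygy_syzygy b).isHomogeneous c

theorem ker_eq_range_matrix (s : LinearQuotientFamily n K) (i : ℕ) :
    LinearMap.ker (Finsupp.linearCombination (MvPolynomial (Fin n) K) (s.iteratedSyzygies i).g) =
      LinearMap.range (Finsupp.linearCombination (MvPolynomial (Fin n) K) (s.matrix i)) :=
  (s.iteratedSyzygies i).hasLinearQuotients.ker_eq_range_syzygy

end LinearQuotientFamily

theorem degree_eq_of_mem_support {R σ : Type*} [CommSemiring R] {f : MvPolynomial σ R} {m : ℕ}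
    (hf : f.IsHomogeneous m) {e : σ →₀ ℕ} (he : e ∈ f.support) : e.degree = m := by
  rw [Finsupp.degree_eq_weight_one]
  exact hf (mem_support_iff.1 he)

theorem mem_span_range_X_of_isHomogeneous_one {R σ : Type*} [CommSemiring R] {f : MvPolynomial σ R}
    (hf : f.IsHomogeneous 1) : f ∈ Ideal.span (Set.range (X : σ → MvPolynomial σ R)) := by
  rw [← Set.image_univ, mem_ideal_span_X_image]
  intro m hm
  by_contra! h0
  have hm0 : m = 0 := Finsupp.ext fun i => h0 i (Set.mem_univ i)
  simpa [hm0] using degree_eq_of_mem_support hf hm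

namespace HasLinearQuotients

variable {ι : Type} [LinearOrder ι] [Finite ι] {g : ι → MvPolynomial (Fin n) K}
  {T : ι → Set (Fin n)} (h : HasLinearQuotients K g T) {d : ℕ}

/-- The linear free resolution, by iterated linear syzygies, of an ideal generated by a family of
forms of degree `d` with linear quotients. -/
noncomputable def resolution (hg : ∀ j, (g j).IsHomogeneous d) :
    GradedFreeResolution (Ideal.span (Set.range g)) :=
  let s : LinearQuotientFamily n K := ⟨MvPolynomial (Fin n) K, ι, g, T, h⟩
  { B := fun i => (s.iteratedSyzygies i).ι
    finite := fun i => (s.iteratedSyzygies i).finite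
    deg := fun i _ => d + i
    d := fun i => Finsupp.linearCombination _ (s.matrix i)
    aug := Finsupp.linearCombination _ g
    aug_homogeneous := fun b e he => by
      have hg' : ∀ j : ι, (Finsupp.linearCombination (MvPolynomial (Fin n) K) g
          (Finsupp.single j 1)).IsHomogeneous d := fun j => by
        rw [Finsupp.linearCombination_single, one_smul]
        exact hg j
      rw [degree_eq_of_mem_support (hg' b) he, Nat.cast_zero, add_zero]
    d_homogeneous := fun i b c e he => by
      rw [degree_eq_of_mem_support (s.isHomogeneous_linearCombination_matrix i b c) he]
      push_cast
      ring
    range_aug := Finsupp.range_linearCombination _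
    exact_zero := s.ker_eq_range_matrix 0
    exact_succ := fun i => s.ker_eq_range_matrix (i + 1) }

theorem isMinimal_resolution (hg : ∀ j, (g j).IsHomogeneous d) :
    (h.resolution hg).IsMinimal := fun i b c =>
  mem_span_range_X_of_isHomogeneous_one
    (LinearQuotientFamily.isHomogeneous_linearCombination_matrix _ i b c)

include h in
theorem regularity_le (hg : ∀ j, (g j).IsHomogeneous d) :
    regularity (Ideal.span (Set.range g)) ≤ ((d : ℝ) : EReal) := by
  refine (iInf₂_le _ (h.isMinimal_resolution hg)).trans (iSup₂_le fun i b => ?_)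
  have hdeg : (h.resolution hg).deg i b - (i : ℤ) = d := add_sub_cancel_right _ _
  rw [hdeg, Int.cast_natCast]

end HasLinearQuotients

end LinearResolution

section LexExchange

variable {σ : Type*} [LinearOrder σ] {B : Set (σ →₀ ℕ)}

theorem toLex_lt_toLex_of_exchange {u v w : σ →₀ ℕ} {s p : σ}
    (hs : ∀ l < s, v l = u l) (hvs : v s < u s) (hp : u p < v p)
    (h : w + Finsupp.single s 1 = u + Finsupp.single p 1) : toLex w < toLex u := by
  have hw := apply_add_ite_of_add_single_eq h
  have hsp : s < p := by
    by_contra! hps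
    rcases hps.eq_or_lt with rfl | hlt
    · omega
    · exact hp.ne' (hs p hlt)
  refine Finsupp.Lex.lt_iff.2 ⟨s, fun l hl => ?_, ?_⟩
  · simpa [hl.ne', (hl.trans hsp).ne'] using hw l
  · have := hw s
    rw [if_pos rfl, if_neg hsp.ne'] at this
    exact Nat.lt_of_succ_le this.le

/-- The variables generating the colon ideal of the monomials of `B` before `a`, in lexicographic
order, by the monomial with exponent `a`. -/
def exchangeVariables (B : Set (σ →₀ ℕ)) (a : σ →₀ ℕ) : Set σ :=
  {p | ∃ s, ∃ w ∈ B, toLex w < toLex a ∧ w + Finsupp.single s 1 = a + Finsupp.single p 1}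

theorem HasExchange.hasLinearQuotients {R : Type*} [CommRing R] (hB : HasExchange B) :
    HasLinearQuotients R
      (fun a : {a : Lex (σ →₀ ℕ) // ofLex a ∈ B} => monomial (ofLex a.1) (1 : R))
      (fun a => exchangeVariables B (ofLex a.1)) where
  exists_syzygy := by
    rintro ⟨a, ha⟩ t ⟨s, w, hw, hwa, h⟩
    have hne : (⟨a, ha⟩ : {a : Lex (σ →₀ ℕ) // ofLex a ∈ B}) ≠ ⟨toLex w, hw⟩ :=
      fun heq => hwa.ne' (congrArg Subtype.val heq)
    refine ⟨Finsupp.single ⟨a, ha⟩ (X t) - Finsupp.single ⟨toLex w, hw⟩ (X s), ?_, fun l => ?_, ?_,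
      fun l hl => ?_⟩
    · rw [LinearMap.mem_ker, map_sub, Finsupp.linearCombination_single,
        Finsupp.linearCombination_single, sub_eq_zero, smul_eq_mul, smul_eq_mul, mul_comm,
        mul_comm (X s), X, X, monomial_mul, monomial_mul, ofLex_toLex, h]
    · exact (isHomogeneous_single_X _ _ _).sub (isHomogeneous_single_X _ _ _)
    · simp [hne.symm]
    · have hwl : (⟨toLex w, hw⟩ : {a : Lex (σ →₀ ℕ) // ofLex a ∈ B}) < l := hwa.trans hl
      simp [hl.ne', hwl.ne']
  mem_span_X := by
    rintro ⟨a, ha⟩ f hf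
    have hfa : f * monomial (ofLex a) 1 ∈
        Ideal.span ((fun v => monomial v (1 : R)) '' {v | v ∈ B ∧ toLex v < a}) := by
      refine (Submodule.span_mono ?_ : Submodule.span _ _ ≤ _) hf
      rintro - ⟨v, hv, rfl⟩
      exact ⟨ofLex v.1, ⟨v.2, hv⟩, rfl⟩
    rw [mem_ideal_span_monomial_image] at hfa
    rw [mem_ideal_span_X_image]
    intro m hm
    obtain ⟨v, ⟨hv, hva⟩, hvm⟩ := hfa (m + ofLex a)
      (by rwa [mem_support_iff, coeff_mul_monomial, mul_one, ← mem_support_iff])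
    obtain ⟨s, hs, hvs⟩ := Finsupp.Lex.lt_iff.1 hva
    obtain ⟨p, hp, w, hw, hwp⟩ := hB _ ha v hv s hvs
    refine ⟨p, ⟨s, w, hw, toLex_lt_toLex_of_exchange hs hvs hp hwp, hwp⟩, ?_⟩
    have := hvm p
    rw [Finsupp.add_apply] at this
    omega

theorem HasExchange.regularity_span_le {n : ℕ} {K : Type*} [Field K] {B : Set (Fin n →₀ ℕ)}
    (hB : HasExchange B) (hfin : B.Finite) {d : ℕ} (hd : ∀ u ∈ B, u.degree = d) :
    regularity (Ideal.span ((fun a => monomial a (1 : K)) '' B)) ≤ ((d : ℝ) : EReal) := by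
  have : Finite {a : Lex (Fin n →₀ ℕ) // ofLex a ∈ B} := hfin
  have hrange : (fun a => monomial a (1 : K)) '' B =
      Set.range fun a : {a : Lex (Fin n →₀ ℕ) // ofLex a ∈ B} => monomial (ofLex a.1) (1 : K) :=
    Set.image_eq_range _ _
  rw [hrange]
  exact hB.hasLinearQuotients.regularity_le fun a => isHomogeneous_monomial _ (hd _ a.2)

end LexExchange

section OrderAlong

variable {σ R : Type*}

section CommSemiring

variable [CommSemiring R]

/-- The order of vanishing of a polynomial along the coordinate subspace on which the variables
`X t`, `t ∈ T`, vanish: the least degree in these variables of a monomial of the polynomial. -/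
noncomputable def orderAlong (T : Set σ) (f : MvPolynomial σ R) : ℕ∞ :=
  (f : MvPowerSeries σ R).weightedOrder (T.indicator 1)

theorem natCast_le_orderAlong_iff {T : Set σ} {f : MvPolynomial σ R} {m : ℕ} :
    (m : ℕ∞) ≤ orderAlong T f ↔ ∀ e ∈ f.support, m ≤ Finsupp.weight (T.indicator 1) e := by
  constructor
  · intro h e he
    have hle := MvPowerSeries.weightedOrder_le (f := (f : MvPowerSeries σ R)) (T.indicator 1)
      (d := e) (by rwa [coeff_coe, ← mem_support_iff])
    exact_mod_cast h.trans hle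
  · intro h
    refine MvPowerSeries.nat_le_weightedOrder _ fun e he => ?_
    rw [coeff_coe, ← notMem_support_iff]
    exact fun hmem => (h e hmem).not_gt he

theorem orderAlong_mul [NoZeroDivisors R] (T : Set σ) (f g : MvPolynomial σ R) :
    orderAlong T (f * g) = orderAlong T f + orderAlong T g := by
  rw [orderAlong, coe_mul, MvPowerSeries.weightedOrder_mul, orderAlong, orderAlong]

theorem mem_span_X_iff_one_le_orderAlong {T : Set σ} {f : MvPolynomial σ R} :
    f ∈ Ideal.span (X '' T) ↔ 1 ≤ orderAlong T f := by
  rw [← Nat.cast_one, natCast_le_orderAlong_iff, mem_ideal_span_X_image]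
  refine forall₂_congr fun e _ => ?_
  classical
  simp only [Nat.one_le_iff_ne_zero, Finsupp.weight_apply, Finsupp.sum, ne_eq,
    Finset.sum_eq_zero_iff, Set.indicator_apply, Finsupp.mem_support_iff, smul_eq_mul,
    mul_eq_zero, not_forall]
  simp only [Pi.one_apply]
  grind

theorem weight_indicator_one (T : Finset σ) (e : σ →₀ ℕ) :
    Finsupp.weight ((T : Set σ).indicator 1) e = ∑ l ∈ T, e l := by
  classical
  simp only [Finsupp.weight_apply, Finsupp.sum, Set.indicator_apply, Finset.mem_coe, Pi.one_apply,
    smul_eq_mul, mul_ite, mul_one, mul_zero, Finset.sum_ite_mem]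
  exact Finset.sum_subset Finset.inter_subset_right fun l hl hne => by simp_all

theorem X_mem_span_X_image_iff [Nontrivial R] {T : Set σ} {l : σ} :
    (X l : MvPolynomial σ R) ∈ Ideal.span (X '' T) ↔ l ∈ T := by
  classical
  simp [mem_ideal_span_X_image, support_X, Finsupp.single_apply]

theorem span_monomial_image_le_span_X_image_iff [Nontrivial R] {B : Set (σ →₀ ℕ)} {T : Set σ} :
    Ideal.span ((fun a => monomial a (1 : R)) '' B) ≤ Ideal.span (X '' T) ↔
      ∀ u ∈ B, ∃ l ∈ T, u l ≠ 0 := by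
  classical
  simp [Ideal.span_le, Set.subset_def, mem_ideal_span_X_image]

theorem monomial_mem_span_monomial_image_iff [Nontrivial R] {B : Set (σ →₀ ℕ)} {c : σ →₀ ℕ} :
    monomial c (1 : R) ∈ Ideal.span ((fun a => monomial a (1 : R)) '' B) ↔ ∃ u ∈ B, u ≤ c := by
  classical
  simp [mem_ideal_span_monomial_image, support_monomial]

end CommSemiring

section IsDomain

variable [CommRing R] [IsDomain R]

theorem isPrime_span_X (T : Set σ) :
    (Ideal.span (X '' T) : Ideal (MvPolynomial σ R)).IsPrime := by
  refine Ideal.isPrime_iff.2 ⟨?_, fun {f g} hfg => ?_⟩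
  · rw [Ne, Ideal.eq_top_iff_one, mem_ideal_span_X_image]
    simp
  · rw [mem_span_X_iff_one_le_orderAlong, orderAlong_mul] at hfg
    rw [mem_span_X_iff_one_le_orderAlong, mem_span_X_iff_one_le_orderAlong]
    simp only [Order.one_le_iff_ne_zero] at *
    contrapose! hfg
    simp [hfg.1, hfg.2]

theorem eq_span_X_of_mem_minimalPrimes {B : Set (σ →₀ ℕ)} {P : Ideal (MvPolynomial σ R)}
    (hP : P ∈ (Ideal.span ((fun a => monomial a (1 : R)) '' B)).minimalPrimes) :
    P = Ideal.span (X '' {l | X l ∈ P}) := by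
  have hprime : P.IsPrime := hP.1.1
  have hle : Ideal.span (X '' {l | X l ∈ P}) ≤ P := Ideal.span_le.2 (Set.image_subset_iff.2 le_rfl)
  refine le_antisymm (hP.2 ⟨isPrime_span_X _, ?_⟩ hle) hle
  refine span_monomial_image_le_span_X_image_iff.2 fun u hu => ?_
  have huP : monomial u (1 : R) ∈ P := hP.1.2 (Ideal.subset_span ⟨u, hu, rfl⟩)
  rw [monomial_eq, map_one, one_mul, Finsupp.prod, hprime.prod_mem_iff] at huP
  obtain ⟨l, hl, hlP⟩ := huP
  exact ⟨l, hprime.mem_of_pow_mem _ hlP, Finsupp.mem_support_iff.1 hl⟩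

theorem exists_eq_zero_of_mem_minimalPrimes {B : Set (σ →₀ ℕ)} {T : Set σ}
    (hT : Ideal.span (X '' T) ∈ (Ideal.span ((fun a => monomial a (1 : R)) '' B)).minimalPrimes)
    {l : σ} (hl : l ∈ T) : ∃ v ∈ B, ∀ m ∈ T, m ≠ l → v m = 0 := by
  by_contra! h
  have hle : (Ideal.span (X '' T) : Ideal (MvPolynomial σ R)) ≤ Ideal.span (X '' (T \ {l})) := by
    refine hT.2 ⟨isPrime_span_X _, span_monomial_image_le_span_X_image_iff.2 fun u hu => ?_⟩
      (Ideal.span_mono (Set.image_mono Set.sdiff_subset))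
    obtain ⟨m, hm, hml, hum⟩ := h u hu
    exact ⟨m, ⟨hm, hml⟩, hum⟩
  exact (X_mem_span_X_image_iff.1 (hle (X_mem_span_X_image_iff.2 hl))).2 rfl

theorem isRadical_span_squarefree {B : Set (σ →₀ ℕ)} (hB : ∀ a ∈ B, ∀ i, a i ≤ 1) :
    (Ideal.span ((fun a => monomial a (1 : R)) '' B)).IsRadical := by
  intro f hf
  rw [mem_ideal_span_monomial_image]
  intro e he
  by_contra! h
  -- The prime generated by the variables not dividing the monomial `e` of `f` separates `f`.
  have hI : Ideal.span ((fun a => monomial a (1 : R)) '' B) ≤ Ideal.span (X '' {l | e l = 0}) := by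
    refine span_monomial_image_le_span_X_image_iff.2 fun u hu => ?_
    by_contra! hsupp
    refine h u hu fun l => ?_
    by_cases hel : e l = 0
    · rw [hsupp l hel, hel]
    · exact (hB u hu l).trans (Nat.one_le_iff_ne_zero.2 hel)
  have hfT := (isPrime_span_X _).isRadical.radical_le_iff.2 hI hf
  obtain ⟨l, hl, hel⟩ := mem_ideal_span_X_image.1 hfT e he
  exact hel hl

end IsDomain

end OrderAlong

theorem HasNoEmbeddedPrimes.of_isRadical {R : Type*} [CommRing R] {I : Ideal R}
    (hI : I.IsRadical) : HasNoEmbeddedPrimes I := by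
  rintro P ⟨hprime, x, hx⟩
  obtain ⟨f, rfl⟩ := Ideal.Quotient.mk_surjective x
  have hcolon : ∀ r, r ∈ Submodule.colon ⊥ {Ideal.Quotient.mk I f} ↔ r * f ∈ I := fun r => by
    rw [Submodule.mem_colon_singleton, Submodule.mem_bot]
    exact Ideal.Quotient.eq_zero_iff_mem (a := r * f)
  have hmem : ∀ r, r ∈ P ↔ r * f ∈ I := by
    refine fun r => ⟨fun hr => ?_, fun hr => hx ▸ Ideal.le_radical ((hcolon r).2 hr)⟩
    obtain ⟨k, hk⟩ := hx ▸ hr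
    refine hI ⟨k + 1, ?_⟩
    have hmul : (r * f) ^ (k + 1) = r ^ k * f * (r * f ^ k) := by ring
    exact hmul ▸ I.mul_mem_right _ ((hcolon _).1 hk)
  have hIP : I ≤ P := fun r hr => (hmem r).2 (I.mul_mem_right f hr)
  refine ⟨⟨hprime, hIP⟩, fun Q ⟨hQ, hIQ⟩ hQP r hr => ?_⟩
  refine (hQ.mem_or_mem (hIQ ((hmem r).1 hr))).resolve_right fun hfQ => ?_
  have hf : f ∈ I := hI ⟨2, by rw [sq]; exact (hmem f).1 (hQP hfQ)⟩
  exact hprime.ne_top ((Ideal.eq_top_iff_one P).2 ((hmem 1).2 (by rwa [one_mul])))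

section Regularity

theorem exists_associatedPrime_of_monomial_notMem {σ R : Type*} [Finite σ] [CommRing R]
    [IsDomain R] [IsNoetherianRing R] {B : Set (σ →₀ ℕ)}
    (hI : HasNoEmbeddedPrimes (Ideal.span ((fun a => monomial a (1 : R)) '' B))) {c : σ →₀ ℕ}
    (hc : monomial c (1 : R) ∉ Ideal.span ((fun a => monomial a (1 : R)) '' B)) :
    ∃ T : Finset σ, Ideal.span (X '' (T : Set σ)) ∈ associatedPrimes (MvPolynomial σ R)
        (MvPolynomial σ R ⧸ Ideal.span ((fun a => monomial a (1 : R)) '' B)) ∧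
      (∀ l ∈ T, ∃ v ∈ B, ∀ m ∈ T, m ≠ l → v m = 0) ∧
      ∀ b, (∃ u ∈ B, u ≤ b + c) → ∃ l ∈ T, b l ≠ 0 := by
  set I := Ideal.span ((fun a => monomial a (1 : R)) '' B) with hIdef
  obtain ⟨P, hP, hcolon⟩ := exists_le_isAssociatedPrime_of_isNoetherianRing (MvPolynomial σ R)
    (Ideal.Quotient.mk I (monomial c 1)) (mt Ideal.Quotient.eq_zero_iff_mem.1 hc)
  obtain ⟨T, hT⟩ := (Set.toFinite {l | (X l : MvPolynomial σ R) ∈ P}).exists_finset_coe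
  have hPT := eq_span_X_of_mem_minimalPrimes (hI P hP)
  rw [← hT] at hPT
  subst hPT
  refine ⟨T, hP, fun l hl => exists_eq_zero_of_mem_minimalPrimes (hI _ hP) hl, fun b hb => ?_⟩
  have hbT : monomial b (1 : R) ∈ Ideal.span (X '' (T : Set σ)) := hcolon <| by
    rw [Submodule.mem_colon_singleton, Submodule.mem_bot]
    refine Ideal.Quotient.eq_zero_iff_mem (a := monomial b 1 * monomial c 1).2 ?_
    rwa [monomial_mul, one_mul, hIdef, monomial_mem_span_monomial_image_iff]
  exact mem_ideal_span_X_image.1 hbT b (by classical simp)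

theorem HasExchange.exists_associatedPrime {σ R : Type*} [Finite σ] [CommRing R] [IsDomain R]
    [IsNoetherianRing R] {B : Set (σ →₀ ℕ)} (hB : HasExchange B) {d : ℕ}
    (hd : ∀ u ∈ B, u.degree = d)
    (hI : HasNoEmbeddedPrimes (Ideal.span ((fun a => monomial a (1 : R)) '' B)))
    {u : σ →₀ ℕ} (hu : u ∈ B) {i : σ} (hi : u i ≠ 0) :
    ∃ T : Finset σ, i ∈ T ∧ (∀ w ∈ B, ∑ l ∈ T, u l ≤ ∑ l ∈ T, w l) ∧
      Ideal.span (X '' (T : Set σ)) ∈ associatedPrimes (MvPolynomial σ R)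
        (MvPolynomial σ R ⧸ Ideal.span ((fun a => monomial a (1 : R)) '' B)) := by
  obtain ⟨c, rfl⟩ : ∃ c, u = Finsupp.single i 1 + c :=
    exists_add_of_le (Finsupp.single_le_iff.2 (Nat.one_le_iff_ne_zero.2 hi))
  have hc : monomial c (1 : R) ∉ Ideal.span ((fun a => monomial a (1 : R)) '' B) := by
    rw [monomial_mem_span_monomial_image_iff]
    rintro ⟨w, hw, hwc⟩
    have hdeg := (hd w hw).trans (hd _ hu).symm
    have hle := Finsupp.degree_mono hwc
    rw [map_add, Finsupp.degree_single] at hdeg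
    omega
  obtain ⟨T, hT, hpriv, hcT⟩ := exists_associatedPrime_of_monomial_notMem hI hc
  have hiT : i ∈ T := by
    obtain ⟨l, hl, hil⟩ := hcT (Finsupp.single i 1) ⟨_, hu, le_rfl⟩
    classical
    rw [Finsupp.single_apply] at hil
    rwa [(ite_ne_right_iff.1 hil).1]
  refine ⟨T, hiT, fun w hw => ?_, hT⟩
  by_contra! hlt
  have hsum : ∑ l ∈ T, w l ≤ ∑ l ∈ T, c l := by
    classical
    simp only [Finsupp.add_apply, Finsupp.single_apply, Finset.sum_add_distrib,
      Finset.sum_ite_eq, if_pos hiT] at hlt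
    omega
  obtain ⟨w', hw', hle⟩ := hB.exists_le_on hpriv hw hsum
  obtain ⟨l, hl, hne⟩ := hcT (w' - c) ⟨w', hw', le_tsub_add⟩
  exact hne (Nat.sub_eq_zero_of_le (hle l hl))

theorem le_symbolicPower {R : Type*} [CommRing R] (I : Ideal R) (k : ℕ) :
    I ^ k ≤ symbolicPower I k :=
  le_iInf fun _ => Ideal.le_comap_map

theorem natCast_le_orderAlong_of_mem_span_pow {σ R : Type*} [CommSemiring R] {B : Set (σ →₀ ℕ)}
    {T : Finset σ} {m : ℕ} (hm : ∀ w ∈ B, m ≤ ∑ l ∈ T, w l) {k : ℕ} {f : MvPolynomial σ R}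
    (hf : f ∈ Ideal.span ((fun a => monomial a (1 : R)) '' B) ^ k) :
    ((k * m : ℕ) : ℕ∞) ≤ orderAlong T f := by
  rw [span_monomial_image_pow, mem_ideal_span_monomial_image] at hf
  refine natCast_le_orderAlong_iff.2 fun e he => ?_
  obtain ⟨w, hw, hwe⟩ := hf e he
  rw [weight_indicator_one]
  refine le_trans ?_ (Finset.sum_le_sum fun l _ => hwe l)
  refine induction_of_mem_nsmul (p := fun k w => k * m ≤ ∑ l ∈ T, w l) (by simp) ?_ hw
  intro k a b hb ha
  simp only [Finsupp.add_apply, Finset.sum_add_distrib, add_one_mul]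
  exact add_le_add ha (hm b hb)

theorem le_sum_of_mem_symbolicPower {σ R : Type*} [CommRing R] [IsDomain R] {B : Set (σ →₀ ℕ)}
    {T : Finset σ} (hT : Ideal.span (X '' (T : Set σ)) ∈ associatedPrimes (MvPolynomial σ R)
        (MvPolynomial σ R ⧸ Ideal.span ((fun a => monomial a (1 : R)) '' B)))
    {m : ℕ} (hm : ∀ w ∈ B, m ≤ ∑ l ∈ T, w l) {k : ℕ} {f : MvPolynomial σ R}
    (hf : f ∈ symbolicPower (Ideal.span ((fun a => monomial a (1 : R)) '' B)) k)
    {e : σ →₀ ℕ} (he : e ∈ f.support) : k * m ≤ ∑ l ∈ T, e l := by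
  have := isPrime_span_X (R := R) (T : Set σ)
  have hfT := (Submodule.mem_iInf _).1 hf ⟨_, hT⟩
  rw [Ideal.mem_comap, IsLocalization.algebraMap_mem_map_algebraMap_iff
    (Ideal.span (X '' (T : Set σ)) : Ideal (MvPolynomial σ R)).primeCompl] at hfT
  obtain ⟨s, hs, hsf⟩ := hfT
  have hs0 : orderAlong T s = 0 := by
    by_contra h0
    exact hs (mem_span_X_iff_one_le_orderAlong.2 (Order.one_le_iff_ne_zero.2 h0))
  have hle := natCast_le_orderAlong_of_mem_span_pow hm hsf
  rw [orderAlong_mul, hs0, zero_add] at hle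
  rw [← weight_indicator_one]
  exact natCast_le_orderAlong_iff.1 hle e he

variable {n : ℕ} {K : Type*} [Field K]

theorem GradedFreeResolution.exists_deg_eq {J : Ideal (MvPolynomial (Fin n) K)}
    (F : GradedFreeResolution J) {a : Fin n →₀ ℕ}
    (ha : Minimal (fun e => ∃ f ∈ J, e ∈ f.support) a) : ∃ b, F.deg 0 b = a.degree := by
  classical
  obtain ⟨f, hf, haf⟩ := ha.1
  obtain ⟨x, rfl⟩ := F.range_aug.ge hf
  have hx : F.aug x = ∑ b ∈ x.support, x b * F.aug (Finsupp.single b 1) := by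
    conv_lhs => rw [← x.sum_single, Finsupp.sum, map_sum]
    refine Finset.sum_congr rfl fun b _ => ?_
    rw [← smul_eq_mul, ← map_smul, Finsupp.smul_single, smul_eq_mul, mul_one]
  rw [mem_support_iff, hx, coeff_sum] at haf
  obtain ⟨b, -, hb⟩ := Finset.exists_ne_zero_of_sum_ne_zero haf
  obtain ⟨e, -, e', he', rfl⟩ := Finset.mem_add.1 (support_mul _ _ (mem_support_iff.2 hb))
  have hJ : F.aug (Finsupp.single b 1) ∈ J := F.range_aug.le (LinearMap.mem_range_self _ _)
  refine ⟨b, ?_⟩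
  rw [← F.aug_homogeneous b e' he', ← ha.eq_of_le ⟨_, hJ, he'⟩ le_add_self]

theorem degree_le_regularity {J : Ideal (MvPolynomial (Fin n) K)} {a : Fin n →₀ ℕ}
    (ha : Minimal (fun e => ∃ f ∈ J, e ∈ f.support) a) :
    ((a.degree : ℝ) : EReal) ≤ regularity J := by
  refine le_iInf₂ fun F _ => ?_
  obtain ⟨b, hb⟩ := F.exists_deg_eq ha
  refine le_iSup₂_of_le 0 b (le_of_eq ?_)
  rw [hb, Nat.cast_zero, sub_zero, Int.cast_natCast]

theorem HasExchange.minimal_nsmul {σ R : Type*} [Finite σ] [CommRing R] [IsDomain R]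
    [IsNoetherianRing R] {B : Set (σ →₀ ℕ)} (hB : HasExchange B) {d : ℕ}
    (hd : ∀ u ∈ B, u.degree = d)
    (hI : HasNoEmbeddedPrimes (Ideal.span ((fun a => monomial a (1 : R)) '' B)))
    {u : σ →₀ ℕ} (hu : u ∈ B) (k : ℕ) :
    Minimal (fun e => ∃ f ∈ symbolicPower (Ideal.span ((fun a => monomial a (1 : R)) '' B)) k,
      e ∈ f.support) (k • u) := by
  classical
  refine ⟨⟨monomial u 1 ^ k, ?_, ?_⟩, ?_⟩
  · exact le_symbolicPower _ k
      (Ideal.pow_mem_pow (Ideal.subset_span (Set.mem_image_of_mem _ hu)) k)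
  · simp [monomial_pow]
  rintro e ⟨f, hf, he⟩ hle i
  by_contra! hi
  have hui : u i ≠ 0 := by
    intro h0
    simp [h0] at hi
  obtain ⟨T, hiT, hmin, hT⟩ := hB.exists_associatedPrime hd hI hu hui
  have hlt : ∑ l ∈ T, e l < ∑ l ∈ T, (k • u) l := Finset.sum_lt_sum (fun l _ => hle l) ⟨i, hiT, hi⟩
  simp only [Finsupp.smul_apply, smul_eq_mul, ← Finset.mul_sum] at hlt
  exact hlt.not_ge (le_sum_of_mem_symbolicPower hT hmin hf he)

theorem HasExchange.regularity_pow_le_symbolicPower {B : Set (Fin n →₀ ℕ)} (hB : HasExchange B)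
    (hfin : B.Finite) (hne : B.Nonempty) {d : ℕ} (hd : ∀ u ∈ B, u.degree = d)
    (hI : HasNoEmbeddedPrimes (Ideal.span ((fun a => monomial a (1 : K)) '' B))) (k : ℕ) :
    regularity (Ideal.span ((fun a => monomial a (1 : K)) '' B) ^ k) ≤
      regularity (symbolicPower (Ideal.span ((fun a => monomial a (1 : K)) '' B)) k) := by
  obtain ⟨u, hu⟩ := hne
  have hdeg : ∀ w ∈ k • B, w.degree = (k • u).degree := fun w hw => by
    rw [map_nsmul, hd u hu]
    refine induction_of_mem_nsmul (p := fun k w => w.degree = k • d) (by simp) ?_ hw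
    intro k a b hb ha
    rw [map_add, ha, hd b hb, succ_nsmul]
  rw [span_monomial_image_pow]
  exact ((hB.nsmul k).regularity_span_le (finite_nsmul hfin k) hdeg).trans
    (degree_le_regularity (hB.minimal_nsmul hd hI hu k))

end Regularity

theorem IsMonomialIdeal.eq_span_minimalExponents {n : ℕ} {K : Type*} [Field K]
    {I : Ideal (MvPolynomial (Fin n) K)} (hI : IsMonomialIdeal I) :
    I = Ideal.span ((fun a => monomial a (1 : K)) '' minimalExponents I) := by
  apply le_antisymm
  · obtain ⟨A, hA⟩ := hI
    conv_lhs => rw [hA]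
    rw [Ideal.span_le]
    rintro - ⟨a, ha, rfl⟩
    obtain ⟨b, hba, hb⟩ := exists_minimal_le_of_wellFoundedLT
      (fun b => monomial b (1 : K) ∈ I) a (by rw [hA]; exact Ideal.subset_span ⟨a, ha, rfl⟩)
    exact monomial_mem_span_monomial_image_iff.2 ⟨b, hb, hba⟩
  · rw [Ideal.span_le]
    rintro - ⟨a, ha, rfl⟩
    exact Minimal.prop (P := fun b => monomial b (1 : K) ∈ I) ha

theorem symbolicPower_bot {R : Type*} [CommRing R] [IsDomain R] {k : ℕ} (hk : k ≠ 0) :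
    symbolicPower (⊥ : Ideal R) k = ⊥ := by
  have hbot : (⊥ : Ideal R) ∈ associatedPrimes R (R ⧸ (⊥ : Ideal R)) := by
    refine ⟨Ideal.isPrime_bot, 1, ?_⟩
    have hcolon : Submodule.colon (⊥ : Submodule R _) {(1 : R ⧸ (⊥ : Ideal R))} = ⊥ := by
      ext r
      rw [Submodule.mem_colon_singleton, Submodule.mem_bot, ← Algebra.algebraMap_eq_smul_one]
      exact Ideal.Quotient.eq_zero_iff_mem
    rw [hcolon, Ideal.isPrime_bot.radical]
  refine eq_bot_iff.2 ((iInf_le _ ⟨⊥, hbot⟩).trans ?_)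
  have := Ideal.isPrime_bot (α := R)
  rw [Ideal.bot_pow hk, Ideal.map_bot,
    Ideal.comap_bot_of_injective _ (FaithfulSMul.algebraMap_injective R _)]

theorem corollary1p3 {n : ℕ} {K : Type*} [Field K] (I : Ideal (MvPolynomial (Fin n) K))
    (hI : IsPolymatroidal I) :
    (IsMatroidal I → HasNoEmbeddedPrimes I) ∧
    (HasNoEmbeddedPrimes I →
      ∀ k : ℕ, 1 ≤ k → regularity (I ^ k) ≤ regularity (symbolicPower I k)) := by
  rcases hI with rfl | ⟨hmon, P, hP, hPI⟩
  · refine ⟨fun _ => .of_isRadical Ideal.isPrime_bot.isRadical, fun _ k hk => ?_⟩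
    have hk0 : k ≠ 0 := Nat.one_le_iff_ne_zero.1 hk
    rw [symbolicPower_bot hk0, Ideal.bot_pow hk0]
  · have hspan := hmon.eq_span_minimalExponents
    refine ⟨fun hmat => ?_, fun hemb k _ => ?_⟩
    · rw [hspan]
      exact .of_isRadical (isRadical_span_squarefree hmat.2)
    · obtain ⟨a, ha⟩ := hP.nonempty
      obtain ⟨u, -, hu⟩ := hP.finite.exists_le_maximal ha
      have hfin : (polymatroidBases P).Finite := hP.finite.subset fun _ hw => hw.1
      rw [hPI] at hspan
      rw [hspan] at hemb ⊢
      exact hP.hasExchange_polymatroidBases.regularity_pow_le_symbolicPower hfin ⟨u, hu⟩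
        (fun v hv => hP.degree_eq hu hv) hemb k
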